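/- Let $k\ge 1$ be an integer. For a finite connected simple graph $G$ with vertex set $V$ and shortest-path distance $d$, put $d_k(x,y)=\min\{d(x,y),k+1\}$. A set $S\subseteq V$ is a distance-$k$ dominating set if for every $u\in V\setminus S$ there is $w\in S$ with $d(u,w)\le k$, and a distance-$k$ resolving set if for all distinct $x,y\in V$ there is $z\in S$ with $d_k(x,z)\ne d_k(y,z)$. Let $\dim_k(G)$ be the minimum cardinality of a distance-$k$ resolving set of $G$, and let $\gamma_L^k(G)$ be the minimum cardinality of a set that is both a distance-$k$ dominating set and a distance-$k$ resolving set of $G$. Let $P_n$ and $C_n$ denote the path and the cycle on $n$ vertices. **Proposition.** Let $G=P_n$ with $n\ge 2$, or $G=C_n$ with $n\ge 3$. Then $$\gamma_L^k(G)=\begin{cases}\dim_k(G)+1 & \text{if } n\equiv 1 \pmod{3k+2},\\ & \text{or } G=P_n \text{ and } n\equiv k+2 \pmod{3k+2},\\ & \text{or } G=C_n,\ n\ge 3k+4 \text{ and } n\equiv k+2 \pmod{3k+2},\\ \dim_k(G) & \text{otherwise.}\end{cases}$$ -/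

import Mathlib

namespace DistK

variable {V : Type*}

/-- The truncated distance `d_k(x, y) = min (d(x, y), k + 1)`; graphs are meant to be connected, so
that `G.dist` is the length of a shortest path. -/
noncomputable def tdist (G : SimpleGraph V) (k : ℕ) (x y : V) : ℕ :=
  min (G.dist x y) (k + 1)

/-- `S` is a distance-`k` dominating set of `G`. -/
def IsDominating (G : SimpleGraph V) (k : ℕ) (S : Finset V) : Prop :=
  ∀ u, u ∉ S → ∃ w ∈ S, G.dist u w ≤ k

/-- `S` is a distance-`k` resolving set of `G`. -/
def IsResolving (G : SimpleGraph V) (k : ℕ) (S : Finset V) : Prop :=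
  ∀ x y, x ≠ y → ∃ z ∈ S, tdist G k x z ≠ tdist G k y z

/-- `S` is a distance-`k` locating-dominating set of `G`. -/
def IsLocatingDominating (G : SimpleGraph V) (k : ℕ) (S : Finset V) : Prop :=
  IsDominating G k S ∧ IsResolving G k S

/-- The distance-`k` dimension `dim_k(G)`: the minimum cardinality of a distance-`k` resolving
set of `G`. -/
noncomputable def dimK (G : SimpleGraph V) (k : ℕ) : ℕ :=
  sInf {m | ∃ S : Finset V, IsResolving G k S ∧ S.card = m}

/-- The distance-`k` location-domination number: the minimum cardinality of a distance-`k`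
locating-dominating set of `G`. -/
noncomputable def locDomK (G : SimpleGraph V) (k : ℕ) : ℕ :=
  sInf {m | ∃ S : Finset V, IsLocatingDominating G k S ∧ S.card = m}

/-- In a finite connected graph the whole vertex set is locating-dominating, so the infima above
are minima over nonempty sets. -/
theorem isLocatingDominating_univ [Fintype V] (G : SimpleGraph V) (hG : G.Connected) (k : ℕ) :
    IsLocatingDominating G k Finset.univ := by
  refine ⟨fun u hu => absurd (Finset.mem_univ u) hu, fun x y hxy => ⟨x, Finset.mem_univ x, ?_⟩⟩
  have h : 0 < G.dist y x := hG.pos_dist_of_ne hxy.symm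
  simp only [tdist, SimpleGraph.dist_self]
  omega

end DistK

/-! Call the elements of `S` sensors. The two neighbours of a sensor are equidistant from it, so
they must be separated by another sensor within distance `k + 1`. Hence a sensor after a long gap is
followed by a short one, and at most half of the sensors can reach `k` new vertices on both sides.
So `s` resolving sensors dominate at most `B(s) = s (k + 1) + ⌊s / 2⌋ k` vertices
(`card_dominated_le`), where `B(2t) = t (3k + 2)` and `B(2t + 1) = t (3k + 2) + k + 1`.

A resolving set may leave one vertex undominated, but not two. Thus `n ≤ B(s)` is necessary for
locating-dominating sets and `n - 1 ≤ B(s)` for resolving sets. Pairs of sensors at distance `k +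
1`, each pair serving `3k + 2` vertices, together with one or two extra sensors, attain both bounds,
except on cycles with `n < 3k + 2`. The two numbers therefore differ exactly when `n - 1` is a value
`B(s)`, that is, when `n` is `1` or `k + 2` modulo `3k + 2`. On the short cycles both numbers equal
`2`, because a single sensor never resolves a cycle. -/

namespace DistK

/-! ### Distances in a layout, and a criterion for resolving. -/

/-- `φ` places the vertices of `G` on consecutive points of a line or of a cycle, modelled by a
commutative ring `R` (`ℤ` or `ZMod n`), so that adjacency means differing by one. -/
structure Layout {V : Type*} (G : SimpleGraph V) {R : Type*} [CommRing R] (φ : V → R) : Prop where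
  injective : Function.Injective φ
  connected : G.Connected
  adj_iff : ∀ x y, G.Adj x y ↔ φ y = φ x + 1 ∨ φ x = φ y + 1
  -- Every vertex of a cycle has both neighbours; on a path the premise puts `x` strictly before
  -- `y`, so `x` is not the last vertex and `y` is not the first.
  exists_next : ∀ x y, ∀ i : ℕ, φ y = φ x + (i + 1 : ℕ) → ∃ x', φ x' = φ x + 1
  exists_prev : ∀ x y, ∀ i : ℕ, φ y = φ x + (i + 1 : ℕ) → ∃ y', φ y = φ y' + 1
  two_ne_zero : (2 : R) ≠ 0

namespace Layout

variable {V R : Type*} [CommRing R] {G : SimpleGraph V} {φ : V → R}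

theorem dist_le_of_eq_add (h : Layout G φ) (i : ℕ) :
    ∀ x y, φ y = φ x + i → G.dist x y ≤ i := by
  induction i with
  | zero =>
    intro x y hxy
    have : y = x := h.injective (by simpa using hxy)
    simp [this]
  | succ i ih =>
    intro x y hxy
    obtain ⟨x', hx'⟩ := h.exists_next x y i hxy
    have h1 : G.dist x' y ≤ i := ih x' y (by rw [hxy, hx']; push_cast; ring)
    have h2 : G.dist x x' = 1 := SimpleGraph.dist_eq_one_iff_adj.2 ((h.adj_iff x x').2 (Or.inl hx'))
    have h3 : G.dist x y ≤ G.dist x x' + G.dist x' y := h.connected.dist_triangle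
    omega

theorem exists_eq_add_of_walk (h : Layout G φ) {x y : V} (p : G.Walk x y) :
    ∃ i : ℕ, i ≤ p.length ∧ (φ y = φ x + i ∨ φ x = φ y + i) := by
  induction p with
  | nil => exact ⟨0, by simp⟩
  | cons hadj p ih =>
    obtain ⟨i, hi, hxy⟩ := ih
    rw [SimpleGraph.Walk.length_cons]
    rcases (h.adj_iff _ _).1 hadj with h1 | h1 <;> rcases hxy with h2 | h2
    · exact ⟨i + 1, by omega, Or.inl (by push_cast; linear_combination h1 + h2)⟩
    · rcases i with _ | i
      · exact ⟨1, by omega, Or.inl (by push_cast at *; linear_combination h1 - h2)⟩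
      · exact ⟨i, by omega, Or.inr (by push_cast at *; linear_combination h2 - h1)⟩
    · rcases i with _ | i
      · exact ⟨1, by omega, Or.inr (by push_cast at *; linear_combination h1 - h2)⟩
      · exact ⟨i, by omega, Or.inl (by push_cast at *; linear_combination h2 - h1)⟩
    · exact ⟨i + 1, by omega, Or.inr (by push_cast; linear_combination h1 + h2)⟩

theorem dist_le_iff (h : Layout G φ) {x y : V} {d : ℕ} :
    G.dist x y ≤ d ↔ ∃ i : ℕ, i ≤ d ∧ (φ y = φ x + i ∨ φ x = φ y + i) := by
  constructor
  · intro hd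
    obtain ⟨p, hp⟩ := h.connected.exists_walk_length_eq_dist x y
    obtain ⟨i, hi, hxy⟩ := h.exists_eq_add_of_walk p
    exact ⟨i, by omega, hxy⟩
  · rintro ⟨i, hi, hxy | hxy⟩
    · exact (h.dist_le_of_eq_add i x y hxy).trans hi
    · rw [SimpleGraph.dist_comm]
      exact (h.dist_le_of_eq_add i y x hxy).trans hi

theorem eq_add_dist (h : Layout G φ) (x y : V) :
    φ y = φ x + G.dist x y ∨ φ x = φ y + G.dist x y := by
  obtain ⟨i, hi, hxy⟩ := h.dist_le_iff.1 (le_refl (G.dist x y))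
  have : G.dist x y ≤ i := h.dist_le_iff.2 ⟨i, le_rfl, hxy⟩
  rwa [show G.dist x y = i by omega]

/-- If two vertices have the same truncated distance to a vertex dominating one of them, then that
vertex is a midpoint of the two. -/
theorem add_eq_two_mul (h : Layout G φ) {k : ℕ} {x y z : V} (hxy : x ≠ y)
    (hz : G.dist x z ≤ k) (ht : tdist G k x z = tdist G k y z) :
    φ x + φ y = 2 * φ z := by
  have hd : G.dist x z = G.dist y z := by simp only [tdist] at ht; omega
  have hφ : φ x ≠ φ y := fun e => hxy (h.injective e)
  have h1 := h.eq_add_dist x z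
  have h2 := h.eq_add_dist y z
  rw [← hd] at h2
  rcases h1 with h1 | h1 <;> rcases h2 with h2 | h2
  · exact absurd (by linear_combination h2 - h1) hφ
  · linear_combination h2 - h1
  · linear_combination h1 - h2
  · exact absurd (by linear_combination h1 - h2) hφ

/-- A set that misses the `k`-neighbourhood of at most one vertex is resolving as soon as each of
its elements is an end of the line or has a close companion in the set which is not antipodal. -/
theorem isResolving (h : Layout G φ) {k : ℕ} {S : Finset V}
    (hdom : ∀ x y, x ≠ y → (∃ z ∈ S, G.dist x z ≤ k) ∨ ∃ z ∈ S, G.dist y z ≤ k)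
    (hcomp : ∀ z ∈ S, (∀ x, φ x + 1 ≠ φ z) ∨ ∃ w ∈ S, ∃ g : ℕ, 1 ≤ g ∧ g ≤ k + 1 ∧
      (φ w = φ z + g ∨ φ z = φ w + g) ∧ (2 * g : R) ≠ 0) :
    IsResolving G k S := by
  have key : ∀ x y, x ≠ y → (∃ z ∈ S, G.dist x z ≤ k) →
      ∃ z ∈ S, tdist G k x z ≠ tdist G k y z := by
    rintro x y hxy ⟨z, hz, hxz⟩
    by_contra! hcon
    have hmid := h.add_eq_two_mul hxy hxz (hcon z hz)
    have hd0 : G.dist x z ≠ 0 := by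
      intro h0
      have hyz : G.dist y z = 0 := by
        have := hcon z hz
        simp only [tdist] at this
        omega
      exact hxy ((h.connected.dist_eq_zero_iff.1 h0).trans (h.connected.dist_eq_zero_iff.1 hyz).symm)
    obtain ⟨d, hd⟩ : ∃ d, G.dist x z = d + 1 := ⟨G.dist x z - 1, by omega⟩
    have hx := h.eq_add_dist x z
    rw [hd] at hx
    -- The distinct vertices `x` and `y` lie on opposite sides of `z`, so `z` has a predecessor and
    -- cannot be the initial end.
    rcases hcomp z hz with hend | ⟨w, hw, g, hg1, hgk, hwz, hg0⟩
    · rcases hx with hx | hx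
      · obtain ⟨y', hy'⟩ := h.exists_prev x z d hx
        exact hend y' hy'.symm
      · obtain ⟨y', hy'⟩ := h.exists_prev y z d (by linear_combination hx - hmid)
        exact hend y' hy'.symm
    -- If `z` and `w` were both midpoints of `x` and `y`, then `2 * g = 0`.
    · have hfar : ¬ (φ x + φ y = 2 * φ w) := by
        intro hm
        apply hg0
        rcases hwz with e | e
        · linear_combination hmid - hm - 2 * e
        · linear_combination hm - hmid - 2 * e
      -- Whichever of `x`, `y` is on the same side of `z` as `w` has distance at most `|d + 1 - g|`
      -- to `w`. This is at most `k`, since `1 ≤ d + 1 ≤ k` and `1 ≤ g ≤ k + 1`.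
      have hxw : G.dist x w ≤ k ∨ G.dist y w ≤ k := by
        have hclose : ∀ v : V, φ v + g = φ w + (d + 1 : ℕ) ∨ φ w + g = φ v + (d + 1 : ℕ) →
            G.dist v w ≤ k := by
          intro v hv
          rw [h.dist_le_iff]
          rcases le_total g (d + 1) with hle | hle
          · obtain ⟨e, he⟩ := Nat.exists_eq_add_of_le hle
            rw [he] at hv
            push_cast at hv
            refine ⟨e, by omega, ?_⟩
            rcases hv with hv | hv
            · exact Or.inr (by linear_combination hv)
            · exact Or.inl (by linear_combination hv)
          · obtain ⟨e, he⟩ := Nat.exists_eq_add_of_le hle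
            rw [he] at hv
            push_cast at hv
            refine ⟨e, by omega, ?_⟩
            rcases hv with hv | hv
            · exact Or.inl (by linear_combination -hv)
            · exact Or.inr (by linear_combination -hv)
        rcases hx with hx | hx <;> rcases hwz with e | e
        · exact Or.inr (hclose y (Or.inl (by linear_combination hmid + hx - e)))
        · exact Or.inl (hclose x (Or.inr (by linear_combination hx - e)))
        · exact Or.inl (hclose x (Or.inl (by linear_combination hx - e)))
        · exact Or.inr (hclose y (Or.inr (by linear_combination hx - hmid - e)))
      rcases hxw with hxw | hyw
      · exact hfar (h.add_eq_two_mul hxy hxw (hcon w hw))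
      · have := h.add_eq_two_mul hxy.symm hyw (hcon w hw).symm
        exact hfar (by linear_combination this)
  intro x y hxy
  rcases hdom x y hxy with hx | hy
  · exact key x y hxy hx
  · obtain ⟨z, hz, hne⟩ := key y x hxy.symm hy
    exact ⟨z, hz, hne.symm⟩

end Layout

/-! ### Paths and cycles as layouts. -/

theorem pathGraph_layout {n : ℕ} (hn : 1 ≤ n) :
    Layout (SimpleGraph.pathGraph n) (fun v : Fin n => ((v : ℕ) : ℤ)) where
  injective x y hxy := by
    simp only at hxy
    ext
    exact_mod_cast hxy
  connected := by
    obtain ⟨m, rfl⟩ : ∃ m, n = m + 1 := ⟨n - 1, by omega⟩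
    exact SimpleGraph.pathGraph_connected m
  adj_iff x y := by
    rw [SimpleGraph.pathGraph_adj]
    omega
  exists_next x y i hxy := ⟨⟨x + 1, by push_cast at hxy; omega⟩, by simp⟩
  exists_prev x y i hxy := ⟨⟨y - 1, by omega⟩, by push_cast at hxy ⊢; omega⟩
  two_ne_zero := by norm_num

theorem natCast_zmod_surjective {n : ℕ} (hn : 1 ≤ n) (a : ZMod n) :
    ∃ v : Fin n, ((v : ℕ) : ZMod n) = a := by
  have : NeZero n := ⟨by omega⟩
  exact ⟨⟨a.val, a.val_lt⟩, by simp⟩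

theorem cycleGraph_layout {n : ℕ} (hn : 3 ≤ n) :
    Layout (SimpleGraph.cycleGraph n) (fun v : Fin n => ((v : ℕ) : ZMod n)) where
  injective x y hxy := by
    ext
    have := (ZMod.natCast_eq_natCast_iff' _ _ _).1 hxy
    rwa [Nat.mod_eq_of_lt x.2, Nat.mod_eq_of_lt y.2] at this
  connected := by
    obtain ⟨m, rfl⟩ : ∃ m, n = m + 1 := ⟨n - 1, by omega⟩
    exact SimpleGraph.cycleGraph_connected
  adj_iff x y := by
    have key : ∀ x y : Fin n, (x - y).val = 1 ↔ ((x : ℕ) : ZMod n) = (y : ℕ) + 1 := by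
      intro x y
      have hx := x.2
      have hy := y.2
      rw [show (((y : ℕ) : ZMod n) + 1) = ((y + 1 : ℕ) : ZMod n) by push_cast; rfl,
        ZMod.natCast_eq_natCast_iff', Nat.mod_eq_of_lt x.2, Fin.sub_def]
      simp only
      rcases Nat.lt_or_ge (y + 1 : ℕ) n with h1 | h1
      · rw [Nat.mod_eq_of_lt h1]
        rcases Nat.lt_or_ge x.val y.val with h2 | h2
        · rw [Nat.mod_eq_of_lt (by omega)]
          omega
        · rw [Nat.mod_eq_sub_mod (by omega), Nat.mod_eq_of_lt (by omega)]
          omega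
      · rw [show (y + 1 : ℕ) = n by omega, Nat.mod_self]
        rcases Nat.lt_or_ge x.val y.val with h2 | h2
        · rw [Nat.mod_eq_of_lt (by omega)]
          omega
        · rw [Nat.mod_eq_sub_mod (by omega), Nat.mod_eq_of_lt (by omega)]
          omega
    rw [SimpleGraph.cycleGraph_adj', key, key]
    tauto
  exists_next x y i hxy := natCast_zmod_surjective (by omega) _
  exists_prev x y i hxy := by
    obtain ⟨v, hv⟩ := natCast_zmod_surjective (n := n) (by omega) ((y : ℕ) - 1)
    exact ⟨v, by rw [hv]; ring⟩
  two_ne_zero := by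
    intro h0
    have : ((2 : ℕ) : ZMod n) = 0 := by exact_mod_cast h0
    rw [ZMod.natCast_eq_zero_iff] at this
    exact absurd (Nat.le_of_dvd (by norm_num) this) (by omega)

/-! ### Upper bounds on the number of vertices served by a resolving set. -/

namespace Layout

variable {V R : Type*} [CommRing R] {G : SimpleGraph V} {φ : V → R}

open Classical in
/-- In a resolving set, every element preceded by a long gap and having a next vertex is followed
by a short gap; hence at most half of the elements are of this kind. -/
theorem two_mul_card_le (h : Layout G φ) {k : ℕ} {S T : Finset V} (hres : IsResolving G k S)
    (hTS : T ⊆ S) (hprev : ∀ z ∈ T, ∃ x, φ z = φ x + 1) (hnext : ∀ z ∈ T, ∃ y, φ y = φ z + 1)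
    (hgap : ∀ z ∈ T, ∀ w ∈ S, ∀ i ≤ k, φ z ≠ φ w + (i + 1 : ℕ)) :
    2 * T.card ≤ S.card := by
  -- The sensor separating the two neighbours of `z` is not `z`, and the long gap excludes the near
  -- positions before `z`; so it follows `z` within `k + 1`.
  have hclose : ∀ z ∈ T, ∃ j : ℕ, (1 ≤ j ∧ j ≤ k + 1) ∧ ∃ w ∈ S, φ w = φ z + j := by
    intro z hz
    obtain ⟨x, hx⟩ := hprev z hz
    obtain ⟨y, hy⟩ := hnext z hz
    have hxy : x ≠ y := by
      rintro rfl
      exact h.two_ne_zero (by linear_combination -hx - hy)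
    obtain ⟨w, hw, hne⟩ := hres x y hxy
    have hwz : φ w ≠ φ z := by
      intro e
      obtain rfl := h.injective e
      have h1 : G.dist x w = 1 :=
        SimpleGraph.dist_eq_one_iff_adj.2 ((h.adj_iff _ _).2 (Or.inl hx))
      have h2 : G.dist y w = 1 :=
        SimpleGraph.dist_eq_one_iff_adj.2 ((h.adj_iff _ _).2 (Or.inr hy))
      exact hne (by simp only [tdist, h1, h2])
    have hd : G.dist x w ≤ k ∨ G.dist y w ≤ k := by
      by_contra! hcon
      exact hne (by simp only [tdist]; omega)
    rcases hd with hd | hd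
    · obtain ⟨i, hi, e | e⟩ := h.dist_le_iff.1 hd
      · rcases i with _ | _ | i
        · exact absurd (by push_cast at *; linear_combination hx - e) (hgap z hz w hw 0 (by omega))
        · exact absurd (by push_cast at *; linear_combination e - hx) hwz
        · exact ⟨i + 1, by omega, w, hw, by push_cast at *; linear_combination e - hx⟩
      · exact absurd (by push_cast at *; linear_combination hx + e) (hgap z hz w hw i hi)
    · obtain ⟨i, hi, e | e⟩ := h.dist_le_iff.1 hd
      · exact ⟨i + 1, by omega, w, hw, by push_cast at *; linear_combination e + hy⟩
      · rcases i with _ | _ | i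
        · exact ⟨1, by omega, w, hw, by push_cast at *; linear_combination hy - e⟩
        · exact absurd (by push_cast at *; linear_combination hy - e) hwz
        · exact absurd (by push_cast at *; linear_combination e - hy)
            (hgap z hz w hw i (by omega))
  -- The first sensor after `z` ends a short gap, hence is outside `T`; being the immediate
  -- successor among sensors, it determines `z`.
  have hmin : ∀ z ∈ T, ∃ w ∈ S \ T, ∃ j : ℕ, φ w = φ z + j ∧
      ∀ w' ∈ S, ∀ j' : ℕ, 1 ≤ j' → j' < j → φ w' ≠ φ z + j' := by
    intro z hz
    obtain ⟨⟨h1, h2⟩, w, hw, e⟩ := Nat.find_spec (hclose z hz)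
    refine ⟨w, Finset.mem_sdiff.2 ⟨hw, fun hwT => ?_⟩, Nat.find (hclose z hz), e, ?_⟩
    · refine hgap w hwT z (hTS hz) (Nat.find (hclose z hz) - 1) (by omega) ?_
      rw [Nat.sub_add_cancel h1]
      exact e
    · intro w' hw' j' hj1 hj' e'
      exact Nat.find_min (hclose z hz) hj' ⟨⟨hj1, by omega⟩, w', hw', e'⟩
  choose! f hf j hj hjmin using hmin
  have hcard : T.card ≤ (S \ T).card := by
    refine Finset.card_le_card_of_injOn f hf ?_
    have hlt : ∀ z ∈ T, ∀ z' ∈ T, f z = f z' → ¬ j z < j z' := by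
      intro z hz z' hz' hff hlt
      refine hjmin z' hz' z (hTS hz) (j z' - j z) (by omega) ?_ ?_
      · have hne : j z ≠ 0 := by
          intro h0
          have e := hj z hz
          rw [h0] at e
          have : f z = z := h.injective (by simpa using e)
          have h2 := hf z hz
          rw [this] at h2
          exact (Finset.mem_sdiff.1 h2).2 hz
        omega
      · have e1 := hj z hz
        have e2 := hj z' hz'
        rw [hff] at e1
        push_cast [Nat.cast_sub hlt.le]
        linear_combination e2 - e1
    intro z hz z' hz' hff
    have hz := Finset.mem_coe.1 hz
    have hz' := Finset.mem_coe.1 hz'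
    have hjj : j z = j z' :=
      le_antisymm (not_lt.1 (hlt z' hz' z hz hff.symm)) (not_lt.1 (hlt z hz z' hz' hff))
    have e1 := hj z hz
    have e2 := hj z' hz'
    rw [hff, hjj] at e1
    exact h.injective (by linear_combination e2 - e1)
  rw [Finset.card_sdiff_of_subset hTS] at hcard
  have := Finset.card_le_card hTS
  omega

open Classical in
/-- A resolving set of size `s` dominates at most `s (k + 1) + ⌊s / 2⌋ k` vertices. -/
theorem card_dominated_le (h : Layout G φ) [Fintype V] {k : ℕ} {S : Finset V}
    (hres : IsResolving G k S) :
    (Finset.univ.filter fun v => ∃ z ∈ S, G.dist v z ≤ k).card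
      ≤ S.card * (k + 1) + S.card / 2 * k := by
  set T := S.filter fun z => (∃ x, φ z = φ x + 1) ∧
    ∀ w ∈ S, ∀ i ≤ k, φ z ≠ φ w + (i + 1 : ℕ) with hT
  have hhalf : 2 * (T.filter fun z => ∃ y, φ y = φ z + 1).card ≤ S.card := by
    refine h.two_mul_card_le hres ?_ ?_ ?_ ?_
    · exact (Finset.filter_subset _ _).trans (Finset.filter_subset _ _)
    · intro z hz
      exact (Finset.mem_filter.1 (Finset.mem_filter.1 hz).1).2.1
    · intro z hz
      exact (Finset.mem_filter.1 hz).2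
    · intro z hz
      exact (Finset.mem_filter.1 (Finset.mem_filter.1 hz).1).2.2
  -- A sensor without a next vertex escapes the halving bound, but it serves nothing after it, which
  -- compensates in the total.
  have hT2 : T.card ≤ (T.filter fun z => ∃ y, φ y = φ z + 1).card +
      (S.filter fun z => ¬ ∃ y, φ y = φ z + 1).card := by
    rw [← Finset.card_filter_add_card_filter_not (s := T) fun z => ∃ y, φ y = φ z + 1]
    gcongr
    exact Finset.filter_subset _ _
  have hS2 := Finset.card_filter_add_card_filter_not (s := S) fun z => ∃ y, φ y = φ z + 1
  -- A dominated vertex is charged to a sensor at or before it within `k` if there is one, and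
  -- otherwise to the nearest sensor after it. In the latter case that sensor has a long gap before
  -- it, so it lies in `T`.
  have hsub : (Finset.univ.filter fun v => ∃ z ∈ S, G.dist v z ≤ k).image φ ⊆
      S.image φ ∪
      (((S.filter fun z => ∃ y, φ y = φ z + 1) ×ˢ Finset.range k).image
        fun p => φ p.1 + (p.2 + 1 : ℕ)) ∪
      ((T ×ˢ Finset.range k).image fun p => φ p.1 - (p.2 + 1 : ℕ)) := by
    intro a ha
    obtain ⟨v, hv, rfl⟩ := Finset.mem_image.1 ha
    obtain ⟨z, hz, hd⟩ := (Finset.mem_filter.1 hv).2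
    rw [Finset.mem_union, Finset.mem_union]
    by_cases hA : ∃ w ∈ S, ∃ i ≤ k, φ v = φ w + (i : ℕ)
    · left
      obtain ⟨w, hw, i, hi, e⟩ := hA
      rcases i with _ | i
      · left
        exact Finset.mem_image.2 ⟨w, hw, by simpa using e.symm⟩
      · right
        refine Finset.mem_image.2 ⟨(w, i), Finset.mem_product.2 ⟨Finset.mem_filter.2 ⟨hw, ?_⟩,
          Finset.mem_range.2 (by omega)⟩, e.symm⟩
        exact h.exists_next w v i e
    · right
      push Not at hA
      have hex : ∃ i : ℕ, i ≤ k ∧ ∃ z ∈ S, φ z = φ v + i := by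
        obtain ⟨i, hi, e | e⟩ := h.dist_le_iff.1 hd
        · exact ⟨i, hi, z, hz, e⟩
        · exact absurd e (hA z hz i hi)
      obtain ⟨hik, w, hw, e⟩ := Nat.find_spec hex
      have hmin := fun m => Nat.find_min hex (m := m)
      generalize Nat.find hex = i at *
      rcases i with _ | i
      · exact absurd (by simpa using e.symm) (hA w hw 0 (by omega))
      refine Finset.mem_image.2 ⟨(w, i), Finset.mem_product.2 ⟨Finset.mem_filter.2
        ⟨hw, h.exists_prev v w i e, ?_⟩, Finset.mem_range.2 (by omega)⟩, ?_⟩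
      · intro w' hw' i' hi' e'
        rcases le_total i i' with hle | hle
        · refine hA w' hw' (i' - i) (by omega) ?_
          push_cast [Nat.cast_sub hle] at *
          linear_combination e' - e
        · rcases hle.eq_or_lt with rfl | hlt
          · refine hA w' hw' 0 (by omega) ?_
            push_cast at *
            linear_combination e' - e
          · refine hmin (i - i') (by omega) ⟨by omega, w', hw', ?_⟩
            push_cast [Nat.cast_sub hle] at *
            linear_combination e - e'
      · simp only
        linear_combination e
  have hcard := Finset.card_le_card hsub
  rw [Finset.card_image_of_injective _ h.injective] at hcard
  have h1 := Finset.card_union_le (S.image φ ∪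
      (((S.filter fun z => ∃ y, φ y = φ z + 1) ×ˢ Finset.range k).image
        fun p => φ p.1 + (p.2 + 1 : ℕ)))
      ((T ×ˢ Finset.range k).image fun p => φ p.1 - (p.2 + 1 : ℕ))
  have h2 := Finset.card_union_le (S.image φ)
      (((S.filter fun z => ∃ y, φ y = φ z + 1) ×ˢ Finset.range k).image
        fun p => φ p.1 + (p.2 + 1 : ℕ))
  have h3 : (S.image φ).card ≤ S.card := Finset.card_image_le
  have h4 : (((S.filter fun z => ∃ y, φ y = φ z + 1) ×ˢ Finset.range k).image
      fun p => φ p.1 + (p.2 + 1 : ℕ)).card ≤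
      (S.filter fun z => ∃ y, φ y = φ z + 1).card * k := by
    refine Finset.card_image_le.trans ?_
    rw [Finset.card_product, Finset.card_range]
  have h5 : ((T ×ˢ Finset.range k).image fun p => φ p.1 - (p.2 + 1 : ℕ)).card ≤ T.card * k := by
    refine Finset.card_image_le.trans ?_
    rw [Finset.card_product, Finset.card_range]
  have h6 : T.card * k ≤ (S.card / 2 + (S.filter fun z => ¬ ∃ y, φ y = φ z + 1).card) * k := by
    refine Nat.mul_le_mul_right k (hT2.trans ?_)
    omega
  have h7 : S.card * (k + 1) + S.card / 2 * k = S.card +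
      (S.filter fun z => ∃ y, φ y = φ z + 1).card * k +
      (S.card / 2 + (S.filter fun z => ¬ ∃ y, φ y = φ z + 1).card) * k := by
    have : S.card * k = (S.filter fun z => ∃ y, φ y = φ z + 1).card * k +
        (S.filter fun z => ¬ ∃ y, φ y = φ z + 1).card * k := by rw [← hS2]; ring
    linarith
  omega

theorem card_le_of_isLocatingDominating (h : Layout G φ) [Fintype V] {k : ℕ} {S : Finset V}
    (hS : IsLocatingDominating G k S) :
    Fintype.card V ≤ S.card * (k + 1) + S.card / 2 * k := by
  classical
  refine le_trans (le_of_eq ?_) (h.card_dominated_le hS.2)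
  rw [Finset.filter_true_of_mem, Finset.card_univ]
  intro v _
  by_cases hv : v ∈ S
  · exact ⟨v, hv, by simp⟩
  · exact hS.1 v hv

/-- Two undominated vertices would have truncated distance `k + 1` to every sensor, so at most one
vertex escapes domination. -/
theorem card_le_of_isResolving (h : Layout G φ) [Fintype V] {k : ℕ} {S : Finset V}
    (hS : IsResolving G k S) :
    Fintype.card V ≤ S.card * (k + 1) + S.card / 2 * k + 1 := by
  classical
  have h1 := Finset.card_filter_add_card_filter_not (s := Finset.univ)
    fun v => ∃ z ∈ S, G.dist v z ≤ k
  have h2 : (Finset.univ.filter fun v => ¬ ∃ z ∈ S, G.dist v z ≤ k).card ≤ 1 := by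
    rw [Finset.card_le_one]
    intro x hx y hy
    by_contra hxy
    obtain ⟨z, hz, hne⟩ := hS x y hxy
    have hx := (Finset.mem_filter.1 hx).2
    have hy := (Finset.mem_filter.1 hy).2
    push Not at hx hy
    have := hx z hz
    have := hy z hz
    exact hne (by simp only [tdist]; omega)
  have h3 := h.card_dominated_le hS
  rw [Finset.card_univ] at h1
  omega

end Layout

/-! ### Constructions of small resolving and locating-dominating sets. -/

/-- Positions of `t` consecutive pairs of sensors, serving the `t` blocks of `3 * k + 2` vertices
that follow the first `r` vertices. -/
def pairPositions (k r t : ℕ) : Finset ℕ :=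
  (Finset.range t).image (fun j => r + j * (3 * k + 2) + k) ∪
    (Finset.range t).image (fun j => r + j * (3 * k + 2) + (2 * k + 1))

theorem card_pairPositions_le (k r t : ℕ) : (pairPositions k r t).card ≤ 2 * t := by
  refine (Finset.card_union_le _ _).trans ?_
  have h1 : ((Finset.range t).image fun j => r + j * (3 * k + 2) + k).card ≤ t := by
    simpa using Finset.card_image_le (s := Finset.range t) (f := fun j => r + j * (3 * k + 2) + k)
  have h2 : ((Finset.range t).image fun j => r + j * (3 * k + 2) + (2 * k + 1)).card ≤ t := by
    simpa using Finset.card_image_le (s := Finset.range t)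
      (f := fun j => r + j * (3 * k + 2) + (2 * k + 1))
  omega

theorem mem_pairPositions {k r t q : ℕ} : q ∈ pairPositions k r t ↔
    ∃ j < t, q = r + j * (3 * k + 2) + k ∨ q = r + j * (3 * k + 2) + (2 * k + 1) := by
  simp only [pairPositions, Finset.mem_union, Finset.mem_image, Finset.mem_range]
  constructor
  · rintro (⟨j, hj, rfl⟩ | ⟨j, hj, rfl⟩)
    · exact ⟨j, hj, Or.inl rfl⟩
    · exact ⟨j, hj, Or.inr rfl⟩
  · rintro ⟨j, hj, rfl | rfl⟩
    · exact Or.inl ⟨j, hj, rfl⟩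
    · exact Or.inr ⟨j, hj, rfl⟩

theorem lt_of_mem_pairPositions {k r t q : ℕ} (hq : q ∈ pairPositions k r t) :
    q < t * (3 * k + 2) + r := by
  obtain ⟨j, hj, h⟩ := mem_pairPositions.1 hq
  have : (j + 1) * (3 * k + 2) ≤ t * (3 * k + 2) := Nat.mul_le_mul_right _ hj
  rw [Nat.add_mul] at this
  omega

theorem exists_mem_pairPositions_near {k r t v : ℕ} (hr : r ≤ v) (hv : v < t * (3 * k + 2) + r) :
    ∃ q ∈ pairPositions k r t, v ≤ q + k ∧ q ≤ v + k := by
  have hj : (v - r) / (3 * k + 2) < t := (Nat.div_lt_iff_lt_mul (by omega)).2 (by omega)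
  have h1 := Nat.div_add_mod' (v - r) (3 * k + 2)
  have h2 := Nat.mod_lt (v - r) (show 0 < 3 * k + 2 by omega)
  -- Within a block, the sensor at offset `k` reaches offsets `0` to `2k`, and the one at `2k + 1`
  -- reaches `k + 1` to `3k + 1`.
  rcases le_or_gt ((v - r) % (3 * k + 2)) (2 * k) with h3 | h3
  · exact ⟨_, mem_pairPositions.2 ⟨_, hj, Or.inl rfl⟩, by omega, by omega⟩
  · exact ⟨_, mem_pairPositions.2 ⟨_, hj, Or.inr rfl⟩, by omega, by omega⟩

theorem exists_mem_pairPositions_companion {k r t q : ℕ} (hq : q ∈ pairPositions k r t) :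
    ∃ w ∈ pairPositions k r t, w = q + (k + 1) ∨ q = w + (k + 1) := by
  obtain ⟨j, hj, h | h⟩ := mem_pairPositions.1 hq
  · exact ⟨_, mem_pairPositions.2 ⟨j, hj, Or.inr rfl⟩, by omega⟩
  · exact ⟨_, mem_pairPositions.2 ⟨j, hj, Or.inl rfl⟩, by omega⟩

namespace Layout

variable {R : Type*} [CommRing R] {n k : ℕ} {G : SimpleGraph (Fin n)}

/-- A resolving set given by positions in `{0, …, n - 1}`, all vertices but possibly the one at
position `u` being dominated. -/
theorem exists_isResolving_of_positions (h : Layout G fun v : Fin n => ((v : ℕ) : R))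
    (Q : Finset ℕ) (hQ : ∀ q ∈ Q, q < n) (u : ℕ)
    (hdom : ∀ v < n, v ≠ u → ∃ q ∈ Q, v ≤ q + k ∧ q ≤ v + k)
    (hcomp : ∀ q ∈ Q, (∀ x : Fin n, ((x : ℕ) : R) + 1 ≠ q) ∨ ∃ w ∈ Q, ∃ g : ℕ, 1 ≤ g ∧ g ≤ k + 1 ∧
      ((w : R) = q + g ∨ (q : R) = w + g) ∧ (2 * g : R) ≠ 0) :
    ∃ S : Finset (Fin n), IsResolving G k S ∧ (n ≤ u → IsDominating G k S) ∧ S.card ≤ Q.card := by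
  have hdom' : ∀ v : Fin n, v.val ≠ u →
      ∃ z ∈ Finset.univ.filter (fun v : Fin n => v.val ∈ Q), G.dist v z ≤ k := by
    intro v hv
    obtain ⟨q, hq, h1, h2⟩ := hdom v v.2 hv
    refine ⟨⟨q, hQ q hq⟩, by simpa using hq, h.dist_le_iff.2 ?_⟩
    rcases le_total v.val q with hle | hle
    · refine ⟨q - v, by omega, Or.inl ?_⟩
      push_cast [Nat.cast_sub hle]
      ring
    · refine ⟨v - q, by omega, Or.inr ?_⟩
      push_cast [Nat.cast_sub hle]
      ring
  refine ⟨Finset.univ.filter fun v : Fin n => v.val ∈ Q, h.isResolving ?_ ?_, ?_, ?_⟩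
  · intro x y hxy
    by_cases hx : x.val = u
    · exact Or.inr (hdom' y fun hy => hxy (Fin.ext (hx.trans hy.symm)))
    · exact Or.inl (hdom' x hx)
  · intro z hz
    rcases hcomp z (by simpa using hz) with h1 | ⟨w, hw, g, hg⟩
    · exact Or.inl h1
    · exact Or.inr ⟨⟨w, hQ w hw⟩, by simpa using hw, g, hg⟩
  · intro hu v _
    exact hdom' v (by have := v.2; omega)
  · refine Finset.card_le_card_of_injOn (fun v : Fin n => v.val) ?_ Fin.val_injective.injOn
    intro v hv
    simpa using hv

/-- The companion condition for sensor positions follows from a companion at a natural distance. -/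
theorem exists_companion_of_nat {Q : Finset ℕ} {q : ℕ} (hex : ∃ w ∈ Q, ∃ g : ℕ, 1 ≤ g ∧ g ≤ k + 1 ∧
      (w = q + g ∨ q = w + g) ∧ (2 * g : R) ≠ 0) :
    ∃ w ∈ Q, ∃ g : ℕ, 1 ≤ g ∧ g ≤ k + 1 ∧
      ((w : R) = q + g ∨ (q : R) = w + g) ∧ (2 * g : R) ≠ 0 := by
  obtain ⟨w, hw, g, h1, h2, h3, h4⟩ := hex
  refine ⟨w, hw, g, h1, h2, ?_, h4⟩
  rcases h3 with rfl | rfl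
  · exact Or.inl (by push_cast; rfl)
  · exact Or.inr (by push_cast; rfl)

theorem pairPositions_companion {r t : ℕ} (h2 : (2 * (k + 1 : ℕ) : R) ≠ 0) {Q : Finset ℕ}
    (hQ : pairPositions k r t ⊆ Q) {q : ℕ} (hq : q ∈ pairPositions k r t) :
    ∃ w ∈ Q, ∃ g : ℕ, 1 ≤ g ∧ g ≤ k + 1 ∧
      ((w : R) = q + g ∨ (q : R) = w + g) ∧ (2 * g : R) ≠ 0 := by
  obtain ⟨w, hw, hwq⟩ := exists_mem_pairPositions_companion hq
  exact exists_companion_of_nat ⟨w, hQ hw, k + 1, by omega, le_rfl, hwq, h2⟩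

theorem exists_isResolving_even (h : Layout G fun v : Fin n => ((v : ℕ) : R)) {t r : ℕ}
    (hn : n = t * (3 * k + 2) + r) (hr : r ≤ 1) (h2 : (2 * (k + 1 : ℕ) : R) ≠ 0) :
    ∃ S : Finset (Fin n), IsResolving G k S ∧ (r = 0 → IsDominating G k S) ∧ S.card ≤ 2 * t := by
  -- The exceptional position `n` means that no vertex is left out; for `r = 1` vertex `0` is left
  -- out.
  refine (h.exists_isResolving_of_positions (k := k) (pairPositions k r t)
    (fun q hq => hn ▸ lt_of_mem_pairPositions hq) (if r = 0 then n else 0) ?_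
    fun q hq => Or.inr (pairPositions_companion h2 (Finset.Subset.refl _) hq)).elim ?_
  · intro v hv hvu
    refine exists_mem_pairPositions_near ?_ (hn ▸ hv)
    split_ifs at hvu <;> omega
  · rintro S ⟨hS, hd, hc⟩
    exact ⟨S, hS, fun h0 => hd (by simp [h0]), hc.trans (card_pairPositions_le k r t)⟩

theorem exists_isResolving_odd (h : Layout G fun v : Fin n => ((v : ℕ) : R)) {t r : ℕ}
    (hn : n = t * (3 * k + 2) + r) (hr0 : 1 ≤ r) (hr : r ≤ k + 2)
    (h2 : t = 0 ∨ (2 * (k + 1 : ℕ) : R) ≠ 0)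
    (h0 : (∀ x : Fin n, ((x : ℕ) : R) + 1 ≠ 0) ∨ (1 ≤ t ∧ (n : R) = 0)) :
    ∃ S : Finset (Fin n), IsResolving G k S ∧ (r ≤ k + 1 → IsDominating G k S) ∧
      S.card ≤ 2 * t + 1 := by
  -- The extra sensor at `0` covers positions `0` to `k`, so only `k + 1` can be missed, when `r = k
  -- + 2`.
  refine (h.exists_isResolving_of_positions (k := k)
    (insert 0 (pairPositions k r t)) ?_ (if r ≤ k + 1 then n else k + 1) ?_ ?_).elim ?_
  · intro q hq
    rcases Finset.mem_insert.1 hq with rfl | hq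
    · omega
    · exact hn ▸ lt_of_mem_pairPositions hq
  · intro v hv hvu
    rcases lt_or_ge v r with hvr | hvr
    · refine ⟨0, Finset.mem_insert_self _ _, ?_, by omega⟩
      split_ifs at hvu <;> omega
    · obtain ⟨q, hq, h1⟩ := exists_mem_pairPositions_near hvr (hn ▸ hv)
      exact ⟨q, Finset.mem_insert_of_mem hq, h1⟩
  · intro q hq
    rcases Finset.mem_insert.1 hq with rfl | hq
    · rcases h0 with h0 | ⟨ht, h0⟩
      · exact Or.inl (by simpa using h0)
      · right
        -- On a cycle the companion of `0` is the last sensor, at `n - (k + 1)`, reached by wrapping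
        -- around.
        refine ⟨n - (k + 1), Finset.mem_insert_of_mem (mem_pairPositions.2
          ⟨t - 1, by omega, Or.inr ?_⟩), k + 1, by omega, le_rfl, Or.inr ?_,
          h2.resolve_left (by omega)⟩
        · obtain ⟨t, rfl⟩ : ∃ t', t = t' + 1 := ⟨t - 1, by omega⟩
          rw [Nat.add_mul] at hn
          simp only [Nat.add_sub_cancel]
          omega
        · have hle : k + 1 ≤ n := by
            have : 1 * (3 * k + 2) ≤ t * (3 * k + 2) := Nat.mul_le_mul_right _ ht
            omega
          rw [Nat.cast_sub hle, h0]
          simp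
    · refine Or.inr (pairPositions_companion (h2.resolve_left ?_) (Finset.subset_insert _ _) hq)
      rintro rfl
      obtain ⟨j, hj, -⟩ := mem_pairPositions.1 hq
      omega
  · rintro S ⟨hS, hd, hc⟩
    refine ⟨S, hS, fun h0 => hd (by simp [h0]), hc.trans ?_⟩
    have := card_pairPositions_le k r t
    have := Finset.card_insert_le 0 (pairPositions k r t)
    omega

theorem exists_isLocatingDominating_even (h : Layout G fun v : Fin n => ((v : ℕ) : R)) {t r : ℕ}
    (hn : n = t * (3 * k + 2) + r) (hr0 : k + 2 ≤ r) (hr : r ≤ 3 * k + 2)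
    (h2 : t = 0 ∨ (2 * (k + 1 : ℕ) : R) ≠ 0)
    (h3 : (2 * (min (r - 1 - k) (k + 1) : ℕ) : R) ≠ 0) :
    ∃ S : Finset (Fin n), IsLocatingDominating G k S ∧ S.card ≤ 2 * t + 2 := by
  -- Subtraction truncates: for `r ≤ 2k + 2` the second sensor sits at `0`, which is why the gap is
  -- `min (r - 1 - k) (k + 1)`.
  refine (h.exists_isResolving_of_positions (k := k)
    (insert (r - 1 - k) (insert (r - 2 * k - 2) (pairPositions k r t))) ?_ n ?_ ?_).elim ?_
  · intro q hq
    rcases Finset.mem_insert.1 hq with rfl | hq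
    · omega
    · rcases Finset.mem_insert.1 hq with rfl | hq
      · omega
      · exact hn ▸ lt_of_mem_pairPositions hq
  · intro v hv _
    rcases lt_or_ge v r with hvr | hvr
    · rcases le_or_gt (r - 1 - k) (v + k) with h4 | h4
      · exact ⟨r - 1 - k, by simp, by omega, h4⟩
      · exact ⟨r - 2 * k - 2, by simp, by omega, by omega⟩
    · obtain ⟨q, hq, h1⟩ := exists_mem_pairPositions_near hvr (hn ▸ hv)
      exact ⟨q, Finset.mem_insert_of_mem (Finset.mem_insert_of_mem hq), h1⟩
  · intro q hq
    right
    rcases Finset.mem_insert.1 hq with rfl | hq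
    · exact exists_companion_of_nat ⟨r - 2 * k - 2, by simp, min (r - 1 - k) (k + 1),
        by omega, by omega, by omega, h3⟩
    · rcases Finset.mem_insert.1 hq with rfl | hq
      · exact exists_companion_of_nat ⟨r - 1 - k, by simp, min (r - 1 - k) (k + 1),
          by omega, by omega, by omega, h3⟩
      · refine pairPositions_companion (h2.resolve_left ?_)
          ((Finset.subset_insert _ _).trans (Finset.subset_insert _ _)) hq
        rintro rfl
        obtain ⟨j, hj, -⟩ := mem_pairPositions.1 hq
        omega
  · rintro S ⟨hS, hd, hc⟩
    refine ⟨S, ⟨hd le_rfl, hS⟩, hc.trans ?_⟩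
    have := card_pairPositions_le k r t
    have := Finset.card_insert_le (r - 2 * k - 2) (pairPositions k r t)
    have := Finset.card_insert_le (r - 1 - k) (insert (r - 2 * k - 2) (pairPositions k r t))
    omega

/-- Two adjacent vertices form a locating-dominating set of a short cycle. -/
theorem exists_isLocatingDominating_short (h : Layout G fun v : Fin n => ((v : ℕ) : R))
    (hn : 2 ≤ n) (hnk : n ≤ 2 * k + 2) (h0 : (n : R) = 0) :
    ∃ S : Finset (Fin n), IsLocatingDominating G k S ∧ S.card ≤ 2 := by
  have h2 : (2 * (1 : ℕ) : R) ≠ 0 := by simpa using h.two_ne_zero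
  refine ⟨{⟨0, by omega⟩, ⟨1, by omega⟩}, ?_, Finset.card_le_two⟩
  have hdom : ∀ v : Fin n, ∃ z ∈ ({⟨0, by omega⟩, ⟨1, by omega⟩} : Finset (Fin n)),
      G.dist v z ≤ k := by
    intro v
    have hv := v.2
    rcases le_or_gt v.val (k + 1) with hle | hlt
    · rcases Nat.eq_zero_or_pos v.val with hv0 | hv0
      · exact ⟨⟨0, by omega⟩, by simp, h.dist_le_iff.2 ⟨0, by omega, by simp [hv0]⟩⟩
      · refine ⟨⟨1, by omega⟩, by simp, h.dist_le_iff.2 ⟨v - 1, by omega, Or.inr ?_⟩⟩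
        push_cast [Nat.cast_sub hv0]
        ring
    · refine ⟨⟨0, by omega⟩, by simp, h.dist_le_iff.2 ⟨n - v, by omega, Or.inl ?_⟩⟩
      push_cast [Nat.cast_sub hv.le]
      rw [h0]
      ring
  refine ⟨fun v _ => hdom v, h.isResolving (fun x _ _ => Or.inl (hdom x)) ?_⟩
  intro z hz
  right
  simp only [Finset.mem_insert, Finset.mem_singleton] at hz
  rcases hz with rfl | rfl
  · exact ⟨⟨1, by omega⟩, by simp, 1, le_rfl, by omega, Or.inl (by simp), h2⟩
  · exact ⟨⟨0, by omega⟩, by simp, 1, le_rfl, by omega, Or.inr (by simp), h2⟩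

end Layout

/-! ### From sets to the two invariants. -/

section Bounds

variable {V : Type*} {G : SimpleGraph V} {k m : ℕ}

theorem dimK_le {S : Finset V} (hS : IsResolving G k S) (hc : S.card ≤ m) : dimK G k ≤ m :=
  le_trans (Nat.sInf_le ⟨S, hS, rfl⟩) hc

theorem locDomK_le {S : Finset V} (hS : IsLocatingDominating G k S) (hc : S.card ≤ m) :
    locDomK G k ≤ m :=
  le_trans (Nat.sInf_le ⟨S, hS, rfl⟩) hc

variable [Fintype V]

theorem exists_isResolving_card_eq_dimK (hG : G.Connected) (k : ℕ) :
    ∃ S : Finset V, IsResolving G k S ∧ S.card = dimK G k :=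
  Nat.sInf_mem (s := {m | ∃ S : Finset V, IsResolving G k S ∧ S.card = m})
    ⟨_, Finset.univ, (isLocatingDominating_univ G hG k).2, rfl⟩

theorem exists_isLocatingDominating_card_eq_locDomK (hG : G.Connected) (k : ℕ) :
    ∃ S : Finset V, IsLocatingDominating G k S ∧ S.card = locDomK G k :=
  Nat.sInf_mem (s := {m | ∃ S : Finset V, IsLocatingDominating G k S ∧ S.card = m})
    ⟨_, Finset.univ, isLocatingDominating_univ G hG k, rfl⟩

theorem dimK_le_locDomK (hG : G.Connected) (k : ℕ) : dimK G k ≤ locDomK G k := by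
  obtain ⟨S, hS, hc⟩ := exists_isLocatingDominating_card_eq_locDomK hG k
  exact dimK_le hS.2 hc.le

end Bounds

/-- The bound is monotone in `s` and equals `t * (3 * k + 2)` at `s = 2 * t`. -/
theorem lt_of_bound_even {k s t N : ℕ} (hN : N ≤ s * (k + 1) + s / 2 * k)
    (ht : t * (3 * k + 2) < N) : 2 * t < s := by
  by_contra! hcon
  have h1 : s * (k + 1) ≤ 2 * t * (k + 1) := Nat.mul_le_mul_right _ hcon
  have h2 : s / 2 * k ≤ t * k := Nat.mul_le_mul_right _ (by omega)
  nlinarith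

theorem lt_of_bound_odd {k s t N : ℕ} (hN : N ≤ s * (k + 1) + s / 2 * k)
    (ht : t * (3 * k + 2) + k + 1 < N) : 2 * t + 1 < s := by
  by_contra! hcon
  have h1 : s * (k + 1) ≤ (2 * t + 1) * (k + 1) := Nat.mul_le_mul_right _ hcon
  have h2 : s / 2 * k ≤ t * k := Nat.mul_le_mul_right _ (by omega)
  nlinarith

namespace Layout

variable {V R : Type*} [CommRing R] {G : SimpleGraph V} {φ : V → R} [Fintype V]

theorem card_le_locDomK (h : Layout G φ) (k : ℕ) :
    Fintype.card V ≤ locDomK G k * (k + 1) + locDomK G k / 2 * k := by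
  obtain ⟨S, hS, hc⟩ := exists_isLocatingDominating_card_eq_locDomK h.connected k
  exact hc ▸ h.card_le_of_isLocatingDominating hS

theorem card_sub_one_le_dimK (h : Layout G φ) (k : ℕ) :
    Fintype.card V - 1 ≤ dimK G k * (k + 1) + dimK G k / 2 * k := by
  obtain ⟨S, hS, hc⟩ := exists_isResolving_card_eq_dimK h.connected k
  have := h.card_le_of_isResolving hS
  rw [hc] at this
  omega

end Layout

/-- A single sensor cannot separate its own two neighbours. -/
theorem two_le_dimK_cycleGraph {n : ℕ} (hn : 3 ≤ n) (k : ℕ) :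
    2 ≤ dimK (SimpleGraph.cycleGraph n) k := by
  have h := cycleGraph_layout hn
  obtain ⟨S, hS, hc⟩ := exists_isResolving_card_eq_dimK h.connected k
  rw [← hc]
  by_contra! hlt
  have hne : S.Nonempty := by
    obtain ⟨z, hz, -⟩ := hS ⟨0, by omega⟩ ⟨1, by omega⟩ (by simp)
    exact ⟨z, hz⟩
  obtain ⟨z, rfl⟩ := Finset.card_eq_one.1 (le_antisymm (by omega) hne.card_pos)
  obtain ⟨x, hx⟩ := natCast_zmod_surjective (n := n) (by omega) ((z : ℕ) - 1)
  obtain ⟨y, hy⟩ := natCast_zmod_surjective (n := n) (by omega) ((z : ℕ) + 1)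
  have hxy : x ≠ y := by
    rintro rfl
    exact h.two_ne_zero (by linear_combination hx - hy)
  obtain ⟨w, hw, hd⟩ := hS x y hxy
  rw [Finset.mem_singleton] at hw
  subst hw
  have h1 : (SimpleGraph.cycleGraph n).dist x w = 1 :=
    SimpleGraph.dist_eq_one_iff_adj.2 ((h.adj_iff _ _).2 (Or.inl (by linear_combination -hx)))
  have h2 : (SimpleGraph.cycleGraph n).dist y w = 1 :=
    SimpleGraph.dist_eq_one_iff_adj.2 ((h.adj_iff _ _).2 (Or.inr (by linear_combination hy)))
  exact hd (by simp only [tdist, h1, h2])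

theorem two_mul_ne_zero_zmod {n g : ℕ} (hg : 0 < g) (hgn : 2 * g < n) :
    (2 * (g : ℕ) : ZMod n) ≠ 0 := by
  intro h0
  have : ((2 * g : ℕ) : ZMod n) = 0 := by exact_mod_cast h0
  rw [ZMod.natCast_eq_zero_iff] at this
  exact absurd (Nat.le_of_dvd (by omega) this) (by omega)

/-! ### Evaluation on paths and cycles according to the residue `r`. -/

theorem locDomK_pathGraph {k t r : ℕ} (hk : 1 ≤ k) (hr : r < 3 * k + 2)
    (hn : 2 ≤ t * (3 * k + 2) + r) :
    locDomK (SimpleGraph.pathGraph (t * (3 * k + 2) + r)) k =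
      if r = 1 ∨ r = k + 2 then dimK (SimpleGraph.pathGraph (t * (3 * k + 2) + r)) k + 1
      else dimK (SimpleGraph.pathGraph (t * (3 * k + 2) + r)) k := by
  obtain ⟨n, hnn⟩ : ∃ n, n = t * (3 * k + 2) + r := ⟨_, rfl⟩
  rw [← hnn] at hn ⊢
  have h := pathGraph_layout (n := n) (by omega)
  have hpos : ∀ g : ℕ, 0 < g → (2 * (g : ℕ) : ℤ) ≠ 0 := fun g hg => by omega
  have hL := h.card_le_locDomK k
  have hD := h.card_sub_one_le_dimK k
  have hDL := dimK_le_locDomK h.connected k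
  rw [Fintype.card_fin] at hL hD
  have hend : ∀ x : Fin n, ((x : ℕ) : ℤ) + 1 ≠ 0 := fun x => by omega
  -- The dimension is `2t` for `r ≤ 1`, `2t + 1` for `2 ≤ r ≤ k + 2`, and `2t + 2` beyond.
  rcases Nat.lt_or_ge r 2 with h1 | h1
  · obtain ⟨S, hS, hd, hc⟩ := h.exists_isResolving_even hnn (by omega) (hpos _ (by omega))
    have hdim := dimK_le hS hc
    have ht : 1 ≤ t := by
      by_contra! h0
      obtain rfl : t = 0 := by omega
      omega
    obtain ⟨t, rfl⟩ : ∃ t', t = t' + 1 := ⟨t - 1, by omega⟩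
    have hdim' : 2 * t + 1 < dimK (SimpleGraph.pathGraph n) k :=
      lt_of_bound_odd hD (by rw [Nat.add_mul] at hnn; omega)
    rcases (show r = 0 ∨ r = 1 by omega) with rfl | rfl
    · have := locDomK_le ⟨hd rfl, hS⟩ hc
      rw [if_neg (by omega)]
      omega
    · obtain ⟨S', hS', hd', hc'⟩ := h.exists_isResolving_odd hnn le_rfl (by omega)
        (Or.inr (hpos _ (by omega))) (Or.inl hend)
      have := locDomK_le ⟨hd' (by omega), hS'⟩ hc'
      have := lt_of_bound_even (t := t + 1) hL (by omega)
      rw [if_pos (Or.inl rfl)]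
      omega
  · rcases Nat.lt_or_ge (k + 2) r with h2 | h2
    · obtain ⟨S, hS, hc⟩ := h.exists_isLocatingDominating_even hnn h2.le hr.le
        (Or.inr (hpos _ (by omega))) (hpos _ (by omega))
      have := locDomK_le hS hc
      have := lt_of_bound_odd (t := t) hD (by omega)
      rw [if_neg (by omega)]
      omega
    · obtain ⟨S, hS, hd, hc⟩ := h.exists_isResolving_odd hnn (by omega) h2
        (Or.inr (hpos _ (by omega))) (Or.inl hend)
      have := dimK_le hS hc
      have := lt_of_bound_even (t := t) hD (by omega)
      rcases h2.eq_or_lt with rfl | h3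
      · obtain ⟨S', hS', hc'⟩ := h.exists_isLocatingDominating_even hnn le_rfl hr.le
          (Or.inr (hpos _ (by omega))) (hpos _ (by omega))
        have := locDomK_le hS' hc'
        have := lt_of_bound_odd (t := t) hL (by omega)
        rw [if_pos (Or.inr rfl)]
        omega
      · have := locDomK_le ⟨hd (by omega), hS⟩ hc
        rw [if_neg (by omega)]
        omega

theorem locDomK_cycleGraph_of_pos {k t r : ℕ} (hk : 1 ≤ k) (ht : 1 ≤ t) (hr : r < 3 * k + 2) :
    locDomK (SimpleGraph.cycleGraph (t * (3 * k + 2) + r)) k =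
      if r = 1 ∨ r = k + 2 then dimK (SimpleGraph.cycleGraph (t * (3 * k + 2) + r)) k + 1
      else dimK (SimpleGraph.cycleGraph (t * (3 * k + 2) + r)) k := by
  obtain ⟨n, hnn⟩ : ∃ n, n = t * (3 * k + 2) + r := ⟨_, rfl⟩
  have hle : 1 * (3 * k + 2) ≤ t * (3 * k + 2) := Nat.mul_le_mul_right _ ht
  rw [← hnn]
  have h := cycleGraph_layout (n := n) (by omega)
  have hpos : ∀ g : ℕ, 0 < g → g ≤ k + 1 → (2 * (g : ℕ) : ZMod n) ≠ 0 :=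
    fun g hg hgk => two_mul_ne_zero_zmod hg (by omega)
  have hL := h.card_le_locDomK k
  have hD := h.card_sub_one_le_dimK k
  have hDL := dimK_le_locDomK h.connected k
  rw [Fintype.card_fin] at hL hD
  have hn0 : (n : ZMod n) = 0 := ZMod.natCast_self n
  rcases Nat.lt_or_ge r 2 with h1 | h1
  · obtain ⟨S, hS, hd, hc⟩ := h.exists_isResolving_even hnn (by omega) (hpos _ (by omega) le_rfl)
    have hdim := dimK_le hS hc
    obtain ⟨t, rfl⟩ : ∃ t', t = t' + 1 := ⟨t - 1, by omega⟩
    have hdim' : 2 * t + 1 < dimK (SimpleGraph.cycleGraph n) k :=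
      lt_of_bound_odd hD (by rw [Nat.add_mul] at hnn; omega)
    rcases (show r = 0 ∨ r = 1 by omega) with rfl | rfl
    · have := locDomK_le ⟨hd rfl, hS⟩ hc
      rw [if_neg (by omega)]
      omega
    · obtain ⟨S', hS', hd', hc'⟩ := h.exists_isResolving_odd hnn le_rfl (by omega)
        (Or.inr (hpos _ (by omega) le_rfl)) (Or.inr ⟨ht, hn0⟩)
      have := locDomK_le ⟨hd' (by omega), hS'⟩ hc'
      have := lt_of_bound_even (t := t + 1) hL (by omega)
      rw [if_pos (Or.inl rfl)]
      omega
  · rcases Nat.lt_or_ge (k + 2) r with h2 | h2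
    · obtain ⟨S, hS, hc⟩ := h.exists_isLocatingDominating_even hnn h2.le hr.le
        (Or.inr (hpos _ (by omega) le_rfl)) (hpos _ (by omega) (by omega))
      have := locDomK_le hS hc
      have := lt_of_bound_odd (t := t) hD (by omega)
      rw [if_neg (by omega)]
      omega
    · obtain ⟨S, hS, hd, hc⟩ := h.exists_isResolving_odd hnn (by omega) h2
        (Or.inr (hpos _ (by omega) le_rfl)) (Or.inr ⟨ht, hn0⟩)
      have := dimK_le hS hc
      have := lt_of_bound_even (t := t) hD (by omega)
      rcases h2.eq_or_lt with rfl | h3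
      · obtain ⟨S', hS', hc'⟩ := h.exists_isLocatingDominating_even hnn le_rfl hr.le
          (Or.inr (hpos _ (by omega) le_rfl)) (hpos _ (by omega) (by omega))
        have := locDomK_le hS' hc'
        have := lt_of_bound_odd (t := t) hL (by omega)
        rw [if_pos (Or.inr rfl)]
        omega
      · have := locDomK_le ⟨hd (by omega), hS⟩ hc
        rw [if_neg (by omega)]
        omega

theorem locDomK_cycleGraph_of_lt {k n : ℕ} (hn : 3 ≤ n) (hnk : n < 3 * k + 2) :
    locDomK (SimpleGraph.cycleGraph n) k = dimK (SimpleGraph.cycleGraph n) k := by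
  have h := cycleGraph_layout hn
  have h1 := two_le_dimK_cycleGraph hn k
  have h2 := dimK_le_locDomK h.connected k
  have h3 : locDomK (SimpleGraph.cycleGraph n) k ≤ 2 := by
    -- At `n = 2k + 2` two sensors at distance `k + 1` would be antipodal, so adjacent ones are used
    -- up to that length.
    rcases Nat.lt_or_ge (2 * k + 2) n with h4 | h4
    · obtain ⟨S, hS, hc⟩ := h.exists_isLocatingDominating_even (t := 0) (r := n) (k := k)
        (by omega) (by omega) hnk.le (Or.inl rfl) (two_mul_ne_zero_zmod (by omega) (by omega))
      exact locDomK_le hS hc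
    · obtain ⟨S, hS, hc⟩ := h.exists_isLocatingDominating_short (by omega) h4
        (ZMod.natCast_self n)
      exact locDomK_le hS hc
  omega

end DistK

theorem mainTheorem10 (k : ℕ) (hk : 1 ≤ k) (n : ℕ) :
    (2 ≤ n →
      DistK.locDomK (SimpleGraph.pathGraph n) k =
        if n ≡ 1 [MOD 3 * k + 2] ∨ n ≡ k + 2 [MOD 3 * k + 2] then
          DistK.dimK (SimpleGraph.pathGraph n) k + 1
        else DistK.dimK (SimpleGraph.pathGraph n) k) ∧
    (3 ≤ n →
      DistK.locDomK (SimpleGraph.cycleGraph n) k =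
        if n ≡ 1 [MOD 3 * k + 2] ∨ (3 * k + 4 ≤ n ∧ n ≡ k + 2 [MOD 3 * k + 2]) then
          DistK.dimK (SimpleGraph.cycleGraph n) k + 1
        else DistK.dimK (SimpleGraph.cycleGraph n) k) := by
  have hr : n % (3 * k + 2) < 3 * k + 2 := Nat.mod_lt _ (by omega)
  have hn := Nat.div_add_mod' n (3 * k + 2)
  have e1 : n ≡ 1 [MOD 3 * k + 2] ↔ n % (3 * k + 2) = 1 := by
    rw [Nat.ModEq, Nat.mod_eq_of_lt (show 1 < 3 * k + 2 by omega)]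
  have e2 : n ≡ k + 2 [MOD 3 * k + 2] ↔ n % (3 * k + 2) = k + 2 := by
    rw [Nat.ModEq, Nat.mod_eq_of_lt (show k + 2 < 3 * k + 2 by omega)]
  simp only [e1, e2]
  constructor
  · intro h2
    have := DistK.locDomK_pathGraph hk hr (t := n / (3 * k + 2)) (by omega)
    rwa [hn] at this
  · intro h3
    rcases Nat.eq_zero_or_pos (n / (3 * k + 2)) with ht | ht
    · have hlt : n < 3 * k + 2 := (Nat.div_eq_zero_iff_lt (by omega)).1 ht
      rw [Nat.mod_eq_of_lt hlt, if_neg (by omega)]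
      exact DistK.locDomK_cycleGraph_of_lt h3 hlt
    · have := DistK.locDomK_cycleGraph_of_pos hk ht hr
      rw [hn] at this
      rw [this]
      have hle : 1 * (3 * k + 2) ≤ n / (3 * k + 2) * (3 * k + 2) := Nat.mul_le_mul_right _ ht
      -- With at least one full block, residue `k + 2` forces `n ≥ 4k + 4`, so the condition `3k + 4
      -- ≤ n` is automatic.
      refine if_congr ?_ rfl rfl
      omega
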